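/- Let $n\ge 2$ and let $\alpha,\beta$ be indeterminates. For $1\le i\le n-1$ let $s_i\in S_n$ be the transposition of $i$ and $i+1$, and let $$\partial_i f=\frac{f(x_1,\dots,x_{i-1},x_{i+1},x_i,x_{i+2},\dots,x_n)-f(x_1,\dots,x_n)}{x_{i+1}-x_i}.$$ For parameters $b,a,c$ put $$T_i^{(b,a,c)}=-b+\bigl((a+b+c)x_i+c\,x_{i+1}+1+(b+c)(a+c)\,x_ix_{i+1}\bigr)\partial_i ,$$ and for $w\in S_n$ with a reduced word $w=s_{i_1}s_{i_2}\cdots s_{i_\ell}$ put $$\mathcal{KN}_w^{(b,a,c)}(\boldsymbol{x};\boldsymbol{0})=T_{i_1}^{(b,a,c)}T_{i_2}^{(b,a,c)}\cdots T_{i_\ell}^{(b,a,c)}\bigl(x_1^{n-1}x_2^{n-2}\cdots x_{n-1}\bigr).$$ Then for every $w\in S_n$ the polynomial $$\mathcal{KN}_w^{(-\beta,-\alpha,\alpha+\beta)}(\boldsymbol{x};\boldsymbol{0})\in\mathbb{C}[\alpha,\beta][x_1,\dots,x_n]$$ does not depend on the choice of the reduced word of $w$, and it lies in $\mathbb{N}[\alpha,\beta][x_1,\dots,x_n]$: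 all of its coefficients are polynomials in $\alpha$ and $\beta$ with non-negative integer coefficients. -/

import Mathlib

open MvPolynomial

namespace TwistedKirillov

/-- The position `i` of the adjacent pair `(i, i + 1)`, with `0`-based indices. -/
def lo {n : ℕ} (i : Fin (n - 1)) : Fin n := ⟨i.val, by omega⟩

/-- The position `i + 1` of the adjacent pair `(i, i + 1)`, with `0`-based indices. -/
def hi {n : ℕ} (i : Fin (n - 1)) : Fin n := ⟨i.val + 1, by omega⟩

/-- The simple transposition exchanging the adjacent positions `i` and `i + 1`. -/
def simpleRefl {n : ℕ} (i : Fin (n - 1)) : Equiv.Perm (Fin n) := Equiv.swap (lo i) (hi i)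

/-- The product `s_{i₁} s_{i₂} ⋯ s_{i_ℓ}` of a word in the simple transpositions. -/
def wordProd {n : ℕ} (l : List (Fin (n - 1))) : Equiv.Perm (Fin n) := (l.map simpleRefl).prod

/-- `l` is a reduced word of `w`: its product is `w`, and no word with product `w` is shorter. -/
def IsReducedWord {n : ℕ} (l : List (Fin (n - 1))) (w : Equiv.Perm (Fin n)) : Prop :=
  wordProd l = w ∧ ∀ l' : List (Fin (n - 1)), wordProd l' = w → l.length ≤ l'.length

theorem exists_word : ∀ {n : ℕ} (w : Equiv.Perm (Fin n)),
    ∃ l : List (Fin (n - 1)), wordProd l = w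
  | 0, w => ⟨[], Subsingleton.elim _ _⟩
  | m + 1, w => by
    have hw : w ∈ Submonoid.closure
        (Set.range fun i : Fin m => Equiv.swap i.castSucc i.succ) := by
      rw [Equiv.Perm.mclosure_swap_castSucc_succ]; trivial
    induction hw using Submonoid.closure_induction with
    | mem x hx =>
      obtain ⟨i, rfl⟩ := hx
      refine ⟨[(i : Fin (m + 1 - 1))], ?_⟩
      simp only [wordProd, List.map_cons, List.map_nil, List.prod_cons, List.prod_nil, mul_one]
      rfl
    | one => exact ⟨[], rfl⟩
    | mul x y _ _ hx hy =>
      obtain ⟨a, rfl⟩ := hx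
      obtain ⟨b, rfl⟩ := hy
      exact ⟨a ++ b, by simp [wordProd]⟩

theorem exists_reducedWord {n : ℕ} (w : Equiv.Perm (Fin n)) :
    ∃ l : List (Fin (n - 1)), IsReducedWord l w := by
  classical
  have h : ∃ k : ℕ, ∃ l : List (Fin (n - 1)), wordProd l = w ∧ l.length = k :=
    (exists_word w).elim fun l hl => ⟨l.length, l, hl, rfl⟩
  obtain ⟨l, hl, hlen⟩ := Nat.find_spec h
  exact ⟨l, hl, fun l' hl' => hlen ▸ Nat.find_min' h ⟨l', hl', rfl⟩⟩

section Operators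

variable {R : Type*} [CommRing R] {n : ℕ}

/-- The difference of `f` with its two variables `x_i`, `x_j` exchanged and `f` itself is
divisible by `x_j - x_i`. -/
theorem X_sub_X_dvd_swap_sub (i j : Fin n) (f : MvPolynomial (Fin n) R) :
    (X j - X i : MvPolynomial (Fin n) R) ∣ rename (Equiv.swap i j) f - f := by
  induction f using MvPolynomial.induction_on with
  | C a => simp
  | add p q hp hq =>
    have h := dvd_add hp hq
    rw [map_add]
    convert h using 1
    ring
  | mul_X p k hp =>
    have hk : (X j - X i : MvPolynomial (Fin n) R) ∣ X (Equiv.swap i j k) - X k := by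
      by_cases h1 : k = i
      · subst h1; simp
      · by_cases h2 : k = j
        · subst h2
          rw [Equiv.swap_apply_right]
          exact ⟨-1, by ring⟩
        · rw [Equiv.swap_apply_of_ne_of_ne h1 h2]; simp
    have h := dvd_add (hp.mul_right (X (Equiv.swap i j k))) (hk.mul_left p)
    rw [map_mul, rename_X]
    convert h using 1
    ring

/-- The divided difference operator
`∂_i f = (f(…, x_{i+1}, x_i, …) - f(…, x_i, x_{i+1}, …)) / (x_{i+1} - x_i)`,
the quotient being taken in the polynomial ring, where `x_{i+1} - x_i` is not a zero divisor. -/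
noncomputable def divDiff (i : Fin (n - 1)) (f : MvPolynomial (Fin n) R) :
    MvPolynomial (Fin n) R :=
  Classical.choose (X_sub_X_dvd_swap_sub (lo i) (hi i) f)

theorem divDiff_spec (i : Fin (n - 1)) (f : MvPolynomial (Fin n) R) :
    rename (simpleRefl i) f - f = (X (hi i) - X (lo i)) * divDiff i f :=
  Classical.choose_spec (X_sub_X_dvd_swap_sub (lo i) (hi i) f)

theorem divDiff_unique [IsDomain R] (i : Fin (n - 1)) (f g : MvPolynomial (Fin n) R)
    (h : rename (simpleRefl i) f - f = (X (hi i) - X (lo i)) * g) : g = divDiff i f := by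
  rw [divDiff_spec] at h
  refine (mul_left_cancel₀ (sub_ne_zero.mpr fun hX => ?_) h).symm
  have := congrArg Fin.val (X_injective (R := R) hX)
  simp [lo, hi] at this

/-- Kirillov's operator `T_i^{(β, α, γ)} =
-β + ((α + β + γ) x_i + γ x_{i+1} + 1 + (β + γ)(α + γ) x_i x_{i+1}) ∂_i`. -/
noncomputable def kirillovOp (β α γ : R) (i : Fin (n - 1)) (f : MvPolynomial (Fin n) R) :
    MvPolynomial (Fin n) R :=
  -C β * f +
    (C (α + β + γ) * X (lo i) + C γ * X (hi i) + 1 +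
      C ((β + γ) * (α + γ)) * X (lo i) * X (hi i)) * divDiff i f

/-- The composition `T_{i₁} T_{i₂} ⋯ T_{i_ℓ}` of Kirillov's operators, applied to `f`. -/
noncomputable def kirillovWord (β α γ : R) (l : List (Fin (n - 1)))
    (f : MvPolynomial (Fin n) R) : MvPolynomial (Fin n) R :=
  l.foldr (fun i g => kirillovOp β α γ i g) f

variable (R) in
/-- The monomial `x_1^{d_1} ⋯ x_n^{d_n}` with `d_i = λ_1 - λ_{n+1-i} + n - i`, where `lam` is the
partition `λ_1 ≥ ⋯ ≥ λ_n`; with `0`-based indices `λ_{n+1-i}` is `lam i.rev`. -/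
noncomputable def seed (lam : Fin n → ℕ) : MvPolynomial (Fin n) R :=
  ∏ i : Fin n, X i ^ (lam ⟨0, i.pos⟩ - lam i.rev + (n - (i.val + 1)))

/-- The twisted Kirillov polynomial `KN_w^{(β, α, γ)}(x; λ)`, computed from a reduced word of `w`.
-/
noncomputable def twistedKirillov (β α γ : R) (w : Equiv.Perm (Fin n)) (lam : Fin n → ℕ) :
    MvPolynomial (Fin n) R :=
  kirillovWord β α γ (Classical.choose (exists_reducedWord w)) (seed R lam)

end Operators

/-- The parameter `α`, an indeterminate of `ℂ[α, β]`. -/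
noncomputable def paramα : MvPolynomial (Fin 2) ℂ := X 0

/-- The parameter `β`, an indeterminate of `ℂ[α, β]`. -/
noncomputable def paramβ : MvPolynomial (Fin 2) ℂ := X 1

/-- `ℕ[α, β][x_1, …, x_n]` inside `ℂ[α, β][x_1, …, x_n]`. -/
noncomputable def natPolynomials (n : ℕ) :
    Subsemiring (MvPolynomial (Fin n) (MvPolynomial (Fin 2) ℂ)) :=
  (map (map (Nat.castRingHom ℂ)) :
    MvPolynomial (Fin n) (MvPolynomial (Fin 2) ℕ) →+*
      MvPolynomial (Fin n) (MvPolynomial (Fin 2) ℂ)).rangeS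

end TwistedKirillov

/-! Up to powers of `β`, the polynomial is the partition function of a solvable coloured lattice
model whose vertex weights contain no minus sign. Row `i` has spectral parameter `x_i`, and `Z_c`
denotes the partition function when row `i` is entered in colour `c i` and every column ends up
holding one prescribed colour.

The weights satisfy a Yang–Baxter relation (`pairWeight_exchange`). Pushed through all the columns
(`twoRowWeight_exchange`) it gives, for `c i < c (i+1)`, `x = x_i` and `y = x_{i+1}`, `(1 + (α+β)y +
αβxy) s_i Z_c = (1+αy)(1+βx) Z_c + β(y-x) Z_{c s_i}`. At the parameters `(-β, -α, α+β)` this says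
exactly `T_i Z_c = β Z_{c s_i}` (`kirillovOp_latticePoly`).

For `c = 1` a single configuration survives, and `Z_1` is `β^N` times the starting monomial, `N =
n(n-1)/2` (`latticePoly_one`). Every letter of a reduced word is an ascent when it is applied, so
`β^N KN_w = β^{ℓ(w)} Z_{w⁻¹}` (`C_mul_kirillovWord`). The right side depends only on `w` and has
coefficients in `ℕ[α, β]`. Cancelling `β^N` gives independence of the word; dividing by it only
shifts exponents, so positivity survives. -/

namespace TwistedKirillov

/-! ### Vertex weights and the local exchange relation -/

section Weights

variable {R : Type*} [CommRing R] {K : Type*} [LinearOrder K] (α β : R)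

/-- The homogeneous `q`-integer `α ^ (m - 1) + α ^ (m - 2) β + ⋯ + β ^ (m - 1)`. -/
def homInt : ℕ → R
  | 0 => 0
  | m + 1 => α ^ m + β * homInt m

/-- The recursion with characteristic roots `α` and `β`. It reduces the integers occurring in one
exchange identity to two consecutive ones, after which `ring` can finish. -/
theorem homInt_add_two (m : ℕ) :
    homInt α β (m + 1 + 1) = (α + β) * homInt α β (m + 1) - α * β * homInt α β m := by
  simp only [homInt]; ring

/-- The factor collected by a path of colour `j` running over the colours in `A`. -/
def overFactor (A : Finset K) (j : K) : R :=
  ∏ a ∈ A, if a < j then α else if j < a then β else 1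

theorem overFactor_insert {A : Finset K} {a : K} (ha : a ∉ A) (j : K) :
    overFactor α β (insert a A) j =
      (if a < j then α else if j < a then β else 1) * overFactor α β A j :=
  Finset.prod_insert ha

/-- The weight of a vertex of the lattice model: a horizontal line with spectral parameter `x`
enters in state `h` and leaves in state `r`, meeting a column holding the colours `A`. -/
def vertexWeight (x : R) (A : Finset K) : Option K → Option K → R
  | none, none => homInt α β (A.card + 1) + α * β * x * homInt α β A.card
  | none, some j => if j ∈ A then (1 + α * x) * (1 + β * x) * overFactor α β A j else 0
  | some _, none => homInt α β (A.card + 1)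
  | some i, some j =>
    if i = j then x * overFactor α β A i
    else if j ∈ A then (if j < i then 1 + β * x else 1 + α * x) * overFactor α β A j else 0

/-- The colours left in a column holding `A` which received `h` and gave away `r`. -/
def columnNext (A : Finset K) : Option K → Option K → Finset K
  | none, none => A
  | none, some j => A.erase j
  | some i, none => insert i A
  | some i, some j => (insert i A).erase j

/-- Two successive vertices in the same column, the one with parameter `y` coming first. -/
def pairWeight (x y : R) (A : Finset K) (c d r s : Option K) : R :=
  vertexWeight α β y A d s * vertexWeight α β x (columnNext A d s) c r

/-- The diagonal coefficient of the exchange relation. -/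
def exchDiag (x y : R) : Option K → Option K → R
  | none, none => 1 + (α + β) * y + α * β * x * y
  | some _, none => (1 + α * x) * (1 + β * x)
  | none, some _ => (1 + α * y) * (1 + β * y)
  | some c, some d =>
    if c < d then (1 + α * y) * (1 + β * x) else (1 + α * x) * (1 + β * y)

/-- The off-diagonal coefficient of the exchange relation. -/
def exchOff (x y : R) : Option K → Option K → R
  | none, none => 0
  | some _, none => y - x
  | none, some _ => α * β * (y - x)
  | some c, some d => if c < d then β * (y - x) else α * (y - x)

/-- Method for all the cases below: only the colours that enter or leave matter individually. Once
those lying in `A` are split off, the remaining set contributes only its `overFactor` and its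
cardinality, and each relative order of the distinguished colours leaves a polynomial identity. -/
theorem pairWeight_exchange_none_none (x y : R) (A : Finset K) (r s : Option K) :
    pairWeight α β y x A none none r s * exchDiag α β x y r s +
        pairWeight α β y x A none none s r * exchOff α β x y s r =
      exchDiag α β x y (none : Option K) none * pairWeight α β x y A none none r s := by
  rcases r with _ | e <;> rcases s with _ | f
  · simp only [pairWeight, vertexWeight, columnNext, exchDiag, exchOff]
    ring
  · by_cases hf : f ∈ A
    · obtain ⟨B, hB, rfl⟩ : ∃ B, f ∉ B ∧ A = insert f B := ⟨A.erase f, by simp, by simp [hf]⟩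
      simp [pairWeight, vertexWeight, columnNext, exchDiag, exchOff, hB, overFactor_insert,
        homInt_add_two]
      ring
    · simp [pairWeight, vertexWeight, columnNext, hf]
  · by_cases hf : e ∈ A
    · obtain ⟨B, hB, rfl⟩ : ∃ B, e ∉ B ∧ A = insert e B := ⟨A.erase e, by simp, by simp [hf]⟩
      simp [pairWeight, vertexWeight, columnNext, exchDiag, exchOff, hB, overFactor_insert,
        homInt_add_two]
      ring
    · simp [pairWeight, vertexWeight, columnNext, hf]
  · by_cases hf : f ∈ A
    · obtain ⟨B, hB, rfl⟩ : ∃ B, f ∉ B ∧ A = insert f B := ⟨A.erase f, by simp, by simp [hf]⟩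
      by_cases hef : e = f
      · subst hef
        simp [pairWeight, vertexWeight, columnNext, hB]
      by_cases he : e ∈ B
      · obtain ⟨B, he, rfl⟩ : ∃ D, e ∉ D ∧ B = insert e D := ⟨B.erase e, by simp, by simp [he]⟩
        rcases lt_or_gt_of_ne hef with h | h <;>
        simp_all [pairWeight, vertexWeight, columnNext, exchDiag, exchOff, overFactor_insert,
          h.ne, h.ne', h.not_gt, Finset.erase_insert_of_ne] <;>
        ring
      · simp [pairWeight, vertexWeight, columnNext, he, hef]
    · simp [pairWeight, vertexWeight, columnNext, hf]
theorem exists_eq_insert_of_mem {A : Finset K} {k : K} (hk : k ∈ A) :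
    ∃ B, k ∉ B ∧ A = insert k B :=
  ⟨A.erase k, by simp, by simp [hk]⟩

theorem pairWeight_exchange_some_none (x y : R) (A : Finset K) {c : K} (hc : c ∉ A)
    (r s : Option K) :
    pairWeight α β y x A (some c) none r s * exchDiag α β x y r s +
        pairWeight α β y x A (some c) none s r * exchOff α β x y s r =
      exchDiag α β x y (some c) none * pairWeight α β x y A (some c) none r s +
        exchOff α β x y (some c) none * pairWeight α β x y A none (some c) r s := by
  rcases r with _ | e <;> rcases s with _ | f
  · simp only [pairWeight, vertexWeight, columnNext, exchDiag, exchOff,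
      Finset.card_insert_of_notMem hc, homInt_add_two]
    ring
  · by_cases hf : f ∈ A
    · obtain ⟨B, hB, rfl⟩ := exists_eq_insert_of_mem hf
      have hcf : c ≠ f := by rintro rfl; exact hc hf
      rcases lt_or_gt_of_ne hcf with h | h <;>
      simp_all [pairWeight, vertexWeight, columnNext, exchDiag, exchOff, overFactor_insert,
        homInt_add_two, h.ne, h.ne', h.not_gt, Finset.erase_insert_of_ne] <;>
      ring
    · by_cases hcf : c = f
      · subst hcf
        simp [pairWeight, vertexWeight, columnNext, exchDiag, exchOff, hc]
        ring
      · simp [pairWeight, vertexWeight, columnNext, hf, hcf, Ne.symm hcf]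
  · by_cases hf : e ∈ A
    · obtain ⟨B, hB, rfl⟩ := exists_eq_insert_of_mem hf
      have hcf : c ≠ e := by rintro rfl; exact hc hf
      rcases lt_or_gt_of_ne hcf with h | h <;>
      simp_all [pairWeight, vertexWeight, columnNext, exchDiag, exchOff, overFactor_insert,
        homInt_add_two, h.ne, h.ne', h.not_gt] <;>
      ring
    · by_cases hcf : c = e
      · subst hcf
        simp [pairWeight, vertexWeight, columnNext, exchDiag, exchOff, hc, overFactor_insert]
        ring
      · simp [pairWeight, vertexWeight, columnNext, hf, hcf, Ne.symm hcf]
  · by_cases hef : e = f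
    · subst hef
      by_cases hce : c = e
      · subst hce
        simp [pairWeight, vertexWeight, columnNext, hc]
      · simp [pairWeight, vertexWeight, columnNext, hce, Ne.symm hce]
    by_cases hf : f ∈ A
    · obtain ⟨B, hB, rfl⟩ := exists_eq_insert_of_mem hf
      have hcf : c ≠ f := by rintro rfl; exact hc hf
      by_cases he : e ∈ B
      · obtain ⟨B, he, rfl⟩ := exists_eq_insert_of_mem he
        have hce : c ≠ e := by rintro rfl; exact hc (by simp)
        -- Of the eight sign patterns for three colours, `order` discards the two cyclic ones.
        rcases lt_or_gt_of_ne hef with h | h <;> rcases lt_or_gt_of_ne hcf with h' | h' <;>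
        rcases lt_or_gt_of_ne hce with h'' | h'' <;> try order
        all_goals
          simp_all [pairWeight, vertexWeight, columnNext, exchDiag, exchOff, overFactor_insert,
            h.ne, h.ne', h.not_gt, h'.ne, h'.ne', h'.not_gt, h''.ne, h''.ne', h''.not_gt,
            Finset.erase_insert_of_ne]
          try ring
      · by_cases hce : c = e
        · subst hce
          rcases lt_or_gt_of_ne hef with h | h <;>
          simp_all [pairWeight, vertexWeight, columnNext, exchDiag, exchOff, overFactor_insert,
            h.ne, h.ne', h.not_gt, Finset.erase_insert_of_ne] <;>
          ring
        · simp [pairWeight, vertexWeight, columnNext, he, hef, hce, Ne.symm hce]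
    · by_cases hcf : c = f
      · subst hcf
        by_cases he : e ∈ A
        · obtain ⟨B, he, rfl⟩ := exists_eq_insert_of_mem he
          rcases lt_or_gt_of_ne hef with h | h <;>
          simp_all [pairWeight, vertexWeight, columnNext, exchDiag, exchOff, overFactor_insert,
            h.ne, h.ne', h.not_gt] <;>
          ring
        · simp [pairWeight, vertexWeight, columnNext, he, Ne.symm hef, hc]
      · simp [pairWeight, vertexWeight, columnNext, hf, hcf, Ne.symm hcf]

theorem pairWeight_exchange_none_some (x y : R) (A : Finset K) {c : K} (hc : c ∉ A)
    (r s : Option K) :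
    pairWeight α β y x A none (some c) r s * exchDiag α β x y r s +
        pairWeight α β y x A none (some c) s r * exchOff α β x y s r =
      exchDiag α β x y none (some c) * pairWeight α β x y A none (some c) r s +
        exchOff α β x y none (some c) * pairWeight α β x y A (some c) none r s := by
  rcases r with _ | e <;> rcases s with _ | f
  · simp only [pairWeight, vertexWeight, columnNext, exchDiag, exchOff,
      Finset.card_insert_of_notMem hc, homInt_add_two]
    ring
  · by_cases hf : f ∈ A
    · obtain ⟨B, hB, rfl⟩ := exists_eq_insert_of_mem hf
      have hcf : c ≠ f := by rintro rfl; exact hc hf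
      rcases lt_or_gt_of_ne hcf with h | h <;>
      simp_all [pairWeight, vertexWeight, columnNext, exchDiag, exchOff, overFactor_insert,
        homInt_add_two, h.ne, h.ne', h.not_gt, Finset.erase_insert_of_ne] <;>
      ring
    · by_cases hcf : c = f
      · subst hcf
        simp [pairWeight, vertexWeight, columnNext, exchDiag, exchOff, hc, overFactor_insert]
        ring
      · simp [pairWeight, vertexWeight, columnNext, hf, hcf, Ne.symm hcf]
  · by_cases hf : e ∈ A
    · obtain ⟨B, hB, rfl⟩ := exists_eq_insert_of_mem hf
      have hcf : c ≠ e := by rintro rfl; exact hc hf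
      rcases lt_or_gt_of_ne hcf with h | h <;>
      simp_all [pairWeight, vertexWeight, columnNext, exchDiag, exchOff, overFactor_insert,
        homInt_add_two, h.ne, h.ne', h.not_gt, Finset.erase_insert_of_ne] <;>
      ring
    · by_cases hcf : c = e
      · subst hcf
        simp [pairWeight, vertexWeight, columnNext, exchDiag, exchOff, hc, overFactor_insert]
        ring
      · simp [pairWeight, vertexWeight, columnNext, hf, hcf, Ne.symm hcf]
  · by_cases hef : e = f
    · subst hef
      by_cases hce : c = e
      · subst hce
        simp [pairWeight, vertexWeight, columnNext, hc]
      · simp [pairWeight, vertexWeight, columnNext, hce, Ne.symm hce]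
    by_cases hf : f ∈ A
    · obtain ⟨B, hB, rfl⟩ := exists_eq_insert_of_mem hf
      have hcf : c ≠ f := by rintro rfl; exact hc hf
      by_cases he : e ∈ B
      · obtain ⟨B, he, rfl⟩ := exists_eq_insert_of_mem he
        have hce : c ≠ e := by rintro rfl; exact hc (by simp)
        rcases lt_or_gt_of_ne hef with h | h <;> rcases lt_or_gt_of_ne hcf with h' | h' <;>
        rcases lt_or_gt_of_ne hce with h'' | h'' <;> try order
        all_goals
          simp_all [pairWeight, vertexWeight, columnNext, exchDiag, exchOff, overFactor_insert,
            h.ne, h.ne', h.not_gt, h'.ne, h'.ne', h'.not_gt, h''.ne, h''.ne', h''.not_gt,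
            Finset.erase_insert_of_ne]
          try ring
      · by_cases hce : c = e
        · subst hce
          rcases lt_or_gt_of_ne hef with h | h <;>
          simp_all [pairWeight, vertexWeight, columnNext, exchDiag, exchOff, overFactor_insert,
            h.ne, h.ne', h.not_gt, Finset.erase_insert_of_ne] <;>
          ring
        · simp [pairWeight, vertexWeight, columnNext, he, hef, hce, Ne.symm hce]
    · by_cases hcf : c = f
      · subst hcf
        by_cases he : e ∈ A
        · obtain ⟨B, he, rfl⟩ := exists_eq_insert_of_mem he
          rcases lt_or_gt_of_ne hef with h | h <;>
          simp_all [pairWeight, vertexWeight, columnNext, exchDiag, exchOff, overFactor_insert,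
            h.ne, h.ne', h.not_gt, Finset.erase_insert_of_ne] <;>
          ring
        · simp [pairWeight, vertexWeight, columnNext, he, hef, Ne.symm hef, hc]
      · simp [pairWeight, vertexWeight, columnNext, hf, hcf, Ne.symm hcf]
theorem pairWeight_exchange_some_some_none (x y : R) (A : Finset K) {c d : K} (hc : c ∉ A)
    (hd : d ∉ A) (hcd : c ≠ d) (f : K) :
    pairWeight α β y x A (some c) (some d) none (some f) * exchDiag α β x y none (some f) +
        pairWeight α β y x A (some c) (some d) (some f) none * exchOff α β x y (some f) none =
      exchDiag α β x y (some c) (some d) *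
          pairWeight α β x y A (some c) (some d) none (some f) +
        exchOff α β x y (some c) (some d) *
          pairWeight α β x y A (some d) (some c) none (some f) ∧
    pairWeight α β y x A (some c) (some d) (some f) none * exchDiag α β x y (some f) none +
        pairWeight α β y x A (some c) (some d) none (some f) * exchOff α β x y none (some f) =
      exchDiag α β x y (some c) (some d) *
          pairWeight α β x y A (some c) (some d) (some f) none +
        exchOff α β x y (some c) (some d) *
          pairWeight α β x y A (some d) (some c) (some f) none := by
  by_cases hf : f ∈ A
  · obtain ⟨B, hB, rfl⟩ := exists_eq_insert_of_mem hf
    have hcf : c ≠ f := by rintro rfl; exact hc hf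
    have hdf : d ≠ f := by rintro rfl; exact hd hf
    constructor <;>
    rcases lt_or_gt_of_ne hcd with h | h <;> rcases lt_or_gt_of_ne hcf with h' | h' <;>
    rcases lt_or_gt_of_ne hdf with h'' | h'' <;> try order
    all_goals
      simp_all [pairWeight, vertexWeight, columnNext, exchDiag, exchOff, overFactor_insert,
        h.ne, h.ne', h.not_gt, h'.ne, h'.ne', h'.not_gt, h''.ne, h''.ne', h''.not_gt,
        homInt_add_two, Finset.erase_insert_of_ne]
      try ring
  · by_cases hcf : c = f
    · subst hcf
      constructor <;>
      rcases lt_or_gt_of_ne hcd with h | h <;>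
      simp [pairWeight, vertexWeight, columnNext, exchDiag, exchOff, overFactor_insert,
        h.ne, h.ne', h.not_gt, h, homInt_add_two, hc, hd] <;>
      ring
    · by_cases hdf : d = f
      · subst hdf
        constructor <;>
        rcases lt_or_gt_of_ne hcd with h | h <;>
        simp [pairWeight, vertexWeight, columnNext, exchDiag, exchOff, overFactor_insert,
          h.ne, h.ne', h.not_gt, h, homInt_add_two, hc, hd] <;>
        ring
      · simp [pairWeight, vertexWeight, columnNext, hf, hcf, Ne.symm hcf, hdf, Ne.symm hdf]

/-- The generic case of four distinct colours: no colour leaves that has just entered, so the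
weights depend only on the relative order. Of the 64 sign patterns, 24 are linear orders. -/
theorem pairWeight_exchange_of_mem (x y : R) (B : Finset K) {c d e f : K}
    (hc : c ∉ insert f (insert e B)) (hd : d ∉ insert f (insert e B)) (hcd : c ≠ d)
    (he : e ∉ B) (hf : f ∉ B) (hef : e ≠ f) :
    pairWeight α β y x (insert f (insert e B)) (some c) (some d) (some e) (some f) *
          exchDiag α β x y (some e) (some f) +
        pairWeight α β y x (insert f (insert e B)) (some c) (some d) (some f) (some e) *
          exchOff α β x y (some f) (some e) =
      exchDiag α β x y (some c) (some d) *
          pairWeight α β x y (insert f (insert e B)) (some c) (some d) (some e) (some f) +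
        exchOff α β x y (some c) (some d) *
          pairWeight α β x y (insert f (insert e B)) (some d) (some c) (some e) (some f) := by
  simp only [Finset.mem_insert, not_or] at hc hd
  obtain ⟨hcf, hce, hcB⟩ := hc
  obtain ⟨hdf, hde, hdB⟩ := hd
  simp only [pairWeight, vertexWeight, columnNext, hcf, hce, hdf, hde, hef, Ne.symm hef,
    if_false, Finset.mem_insert, or_true, if_true,
    Finset.erase_insert_of_ne, ne_eq, not_false_eq_true, Finset.erase_insert,
    or_false, he, hf, hcB, hdB, overFactor_insert, exchDiag, exchOff]
  rcases lt_or_gt_of_ne hef with h | h <;> rcases lt_or_gt_of_ne hcf with h₁ | h₁ <;>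
  rcases lt_or_gt_of_ne hce with h₂ | h₂ <;> rcases lt_or_gt_of_ne hdf with h₃ | h₃ <;>
  rcases lt_or_gt_of_ne hde with h₄ | h₄ <;> rcases lt_or_gt_of_ne hcd with h₅ | h₅ <;>
  try order
  all_goals
    simp [h, h.not_gt, h₁, h₁.not_gt, h₂, h₂.not_gt, h₃, h₃.not_gt, h₄, h₄.not_gt, h₅, h₅.not_gt]
    ring

theorem pairWeight_exchange_some_some_some_some (x y : R) (A : Finset K) {c d : K} (hc : c ∉ A)
    (hd : d ∉ A) (hcd : c ≠ d) (e f : K) :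
    pairWeight α β y x A (some c) (some d) (some e) (some f) *
          exchDiag α β x y (some e) (some f) +
        pairWeight α β y x A (some c) (some d) (some f) (some e) *
          exchOff α β x y (some f) (some e) =
      exchDiag α β x y (some c) (some d) *
          pairWeight α β x y A (some c) (some d) (some e) (some f) +
        exchOff α β x y (some c) (some d) *
          pairWeight α β x y A (some d) (some c) (some e) (some f) := by
  by_cases hef : e = f
  · subst hef
    by_cases hce : c = e
    · subst hce
      simp [pairWeight, vertexWeight, columnNext, hc, hcd, Ne.symm hcd]
    by_cases hde : d = e
    · subst hde
      simp [pairWeight, vertexWeight, columnNext, hd, hcd, Ne.symm hcd]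
    · simp [pairWeight, vertexWeight, columnNext, hce, hde, Ne.symm hce]
  by_cases hf : f ∈ A
  · obtain ⟨B, hB, rfl⟩ := exists_eq_insert_of_mem hf
    have hcf : c ≠ f := by rintro rfl; exact hc hf
    have hdf : d ≠ f := by rintro rfl; exact hd hf
    by_cases he : e ∈ B
    · obtain ⟨B, he', rfl⟩ := exists_eq_insert_of_mem he
      simp only [Finset.mem_insert, not_or] at hB
      exact pairWeight_exchange_of_mem α β x y B hc hd hcd he' hB.2 hef
    · by_cases hce : c = e
      · subst hce
        rcases lt_or_gt_of_ne hcf with h | h <;> rcases lt_or_gt_of_ne hdf with h' | h' <;>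
        rcases lt_or_gt_of_ne hcd with h'' | h'' <;> try order
        all_goals
          simp_all [pairWeight, vertexWeight, columnNext, exchDiag, exchOff, overFactor_insert,
            h.ne, h.ne', h.not_gt, h'.ne, h'.ne', h'.not_gt, h''.ne, h''.ne', h''.not_gt,
            Finset.erase_insert_of_ne]
          try ring
      by_cases hde : d = e
      · subst hde
        rcases lt_or_gt_of_ne hcf with h | h <;> rcases lt_or_gt_of_ne hdf with h' | h' <;>
        rcases lt_or_gt_of_ne hcd with h'' | h'' <;> try order
        all_goals
          simp_all [pairWeight, vertexWeight, columnNext, exchDiag, exchOff, overFactor_insert,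
            h.ne, h.ne', h.not_gt, h'.ne, h'.ne', h'.not_gt, h''.ne, h''.ne', h''.not_gt,
            Finset.erase_insert_of_ne]
          try ring
      · simp [pairWeight, vertexWeight, columnNext, he, hef, hce, Ne.symm hce, hde, Ne.symm hde]
  by_cases he : e ∈ A
  · obtain ⟨B, he', rfl⟩ := exists_eq_insert_of_mem he
    have hce : c ≠ e := by rintro rfl; exact hc (by simp)
    have hde : d ≠ e := by rintro rfl; exact hd (by simp)
    by_cases hcf : c = f
    · subst hcf
      rcases lt_or_gt_of_ne hce with h | h <;> rcases lt_or_gt_of_ne hde with h' | h' <;>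
      rcases lt_or_gt_of_ne hcd with h'' | h'' <;> try order
      all_goals
        simp_all [pairWeight, vertexWeight, columnNext, exchDiag, exchOff, overFactor_insert,
          h.ne, h.ne', h.not_gt, h'.ne, h'.ne', h'.not_gt, h''.ne, h''.ne', h''.not_gt,
          Finset.erase_insert_of_ne]
        try ring
    by_cases hdf : d = f
    · subst hdf
      rcases lt_or_gt_of_ne hce with h | h <;> rcases lt_or_gt_of_ne hde with h' | h' <;>
      rcases lt_or_gt_of_ne hcd with h'' | h'' <;> try order
      all_goals
        simp_all [pairWeight, vertexWeight, columnNext, exchDiag, exchOff, overFactor_insert,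
          h.ne, h.ne', h.not_gt, h'.ne, h'.ne', h'.not_gt, h''.ne, h''.ne', h''.not_gt,
          Finset.erase_insert_of_ne]
        try ring
    · simp [pairWeight, vertexWeight, columnNext, hf, hcf, Ne.symm hcf, hdf, Ne.symm hdf]
  -- Neither `e` nor `f` comes from the column, so all terms vanish unless `{e, f} = {c, d}`.
  · by_cases hce : c = e <;> by_cases hde : d = e <;> by_cases hcf : c = f <;>
      by_cases hdf : d = f
    all_goals try subst hce
    all_goals try subst hde
    all_goals try subst hcf
    all_goals try subst hdf
    all_goals try rcases lt_or_gt_of_ne hcd with h | h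
    all_goals
      simp_all [pairWeight, vertexWeight, columnNext, exchDiag, exchOff, overFactor_insert,
        Ne.symm]
    all_goals try simp_all [h.ne, h.ne', h.not_gt]
    all_goals try ring

end Weights

/-! ### Two successive rows and the train argument -/

theorem sum_sum_sum_sum_comm {R : Type*} [AddCommMonoid R] {S T U V : Type*} [Fintype S]
    [Fintype T] [Fintype U] [Fintype V] (F : S → T → U → V → R) :
    ∑ a, ∑ b, ∑ c, ∑ d, F a b c d = ∑ d, ∑ c, ∑ a, ∑ b, F a b c d :=
  calc
    _ = ∑ a, ∑ c, ∑ b, ∑ d, F a b c d := Finset.sum_congr rfl fun _ _ => Finset.sum_comm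
    _ = ∑ c, ∑ a, ∑ b, ∑ d, F a b c d := Finset.sum_comm
    _ = ∑ c, ∑ a, ∑ d, ∑ b, F a b c d :=
      Finset.sum_congr rfl fun _ _ => Finset.sum_congr rfl fun _ _ => Finset.sum_comm
    _ = ∑ c, ∑ d, ∑ a, ∑ b, F a b c d := Finset.sum_congr rfl fun _ _ => Finset.sum_comm
    _ = _ := Finset.sum_comm

section Rows

variable {R : Type*} [CommRing R] {K : Type*} [LinearOrder K] (α β : R)

/-- The colours of a column holding `A`, after it received `c`, `d` and gave away `r`, `s`. -/
theorem columnNext_columnNext {x y : R} {A : Finset K} {c d r s : Option K}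
    (hc : ∀ k, c = some k → k ∉ A) (hd : ∀ k, d = some k → k ∉ A)
    (hcd : ∀ k, c = some k → d ≠ some k) (h : pairWeight α β x y A c d r s ≠ 0) (k : K) :
    k ∈ columnNext (columnNext A d s) c r ↔
      (k ∈ A ∨ c = some k ∨ d = some k) ∧ r ≠ some k ∧ s ≠ some k := by
  rcases c with _ | c <;> rcases d with _ | d <;> rcases r with _ | r <;> rcases s with _ | s <;>
  simp [pairWeight, vertexWeight, columnNext] at * <;> grind

/-- Conservation of colours. In the train argument it shows that the states passed to the next
column are again distinct and absent from the columns ahead. -/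
theorem available_of_pairWeight_ne_zero {x y : R} {A : Finset K} {c d r s : Option K}
    (hc : ∀ k, c = some k → k ∉ A) (hd : ∀ k, d = some k → k ∉ A)
    (hcd : ∀ k, c = some k → d ≠ some k) (h : pairWeight α β x y A c d r s ≠ 0) :
    (∀ k, r = some k → k ∈ A ∨ c = some k ∨ d = some k) ∧
    (∀ k, s = some k → k ∈ A ∨ c = some k ∨ d = some k) ∧
    ∀ k, r = some k → s ≠ some k := by
  rcases c with _ | c <;> rcases d with _ | d <;> rcases r with _ | r <;> rcases s with _ | s <;>
  simp [pairWeight, vertexWeight, columnNext] at * <;> grind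

/-- The Yang–Baxter relation: the crossing of two rows, with coefficients `exchDiag` and `exchOff`,
moves from one side of a column to the other. The hypotheses say that no colour occurs twice. -/
theorem pairWeight_exchange (x y : R) {A : Finset K} {c d : Option K}
    (hc : ∀ k, c = some k → k ∉ A) (hd : ∀ k, d = some k → k ∉ A)
    (hcd : ∀ k, c = some k → d ≠ some k) (r s : Option K) :
    pairWeight α β y x A c d r s * exchDiag α β x y r s +
        pairWeight α β y x A c d s r * exchOff α β x y s r =
      exchDiag α β x y c d * pairWeight α β x y A c d r s +
        exchOff α β x y c d * pairWeight α β x y A d c r s := by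
  rcases c with _ | c <;> rcases d with _ | d
  · rw [pairWeight_exchange_none_none]; simp [exchOff]
  · exact pairWeight_exchange_none_some α β x y A (hd d rfl) r s
  · exact pairWeight_exchange_some_none α β x y A (hc c rfl) r s
  · have hcd' : c ≠ d := fun h => hcd c rfl (by rw [h])
    rcases r with _ | e <;> rcases s with _ | f
    · simp only [pairWeight, vertexWeight, columnNext, exchDiag, exchOff,
        Finset.card_insert_of_notMem (hc c rfl), Finset.card_insert_of_notMem (hd d rfl),
        homInt_add_two]
      split_ifs <;> ring
    · exact (pairWeight_exchange_some_some_none α β x y A (hc c rfl) (hd d rfl) hcd' f).1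
    · exact (pairWeight_exchange_some_some_none α β x y A (hc c rfl) (hd d rfl) hcd' e).2
    · exact pairWeight_exchange_some_some_some_some α β x y A (hc c rfl) (hd d rfl) hcd' e f

variable [Fintype K]

/-- The partition function of a row with spectral parameter `x` which is entered in state `h` and
left empty, and which turns the columns `A` into the columns `B`. -/
def rowWeight (x : R) : (N : ℕ) → Option K → (Fin N → Finset K) → (Fin N → Finset K) → R
  | 0, none, _, _ => 1
  | 0, some _, _, _ => 0
  | N + 1, h, A, B => ∑ r : Option K, if B 0 = columnNext (A 0) h r then
      vertexWeight α β x (A 0) h r * rowWeight x N r (Fin.tail A) (Fin.tail B) else 0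

/-- The partition function of two successive rows, the row with parameter `y` coming first. -/
def twoRowWeight (x y : R) (N : ℕ) (c d : Option K) (A D : Fin N → Finset K) : R :=
  ∑ B : Fin N → Finset K, rowWeight α β y N d A B * rowWeight α β x N c B D

theorem twoRowWeight_succ (x y : R) (N : ℕ) (c d : Option K) (A D : Fin (N + 1) → Finset K) :
    twoRowWeight α β x y (N + 1) c d A D =
      ∑ r : Option K, ∑ s : Option K,
        (if D 0 = columnNext (columnNext (A 0) d s) c r then pairWeight α β x y (A 0) c d r s
          else 0) * twoRowWeight α β x y N r s (Fin.tail A) (Fin.tail D) := by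
  have key : twoRowWeight α β x y (N + 1) c d A D =
      ∑ b : Finset K, ∑ B : Fin N → Finset K, ∑ s : Option K, ∑ r : Option K,
        if b = columnNext (A 0) d s then
          (if D 0 = columnNext b c r then
            vertexWeight α β y (A 0) d s * rowWeight α β y N s (Fin.tail A) B *
            (vertexWeight α β x b c r * rowWeight α β x N r B (Fin.tail D)) else 0) else 0 := by
    rw [twoRowWeight, ← (Fin.consEquiv fun _ => Finset K).sum_comp, Fintype.sum_prod_type]
    refine Finset.sum_congr rfl fun b _ => Finset.sum_congr rfl fun B _ => ?_
    have h0 : (Fin.consEquiv fun _ => Finset K) (b, B) 0 = b := rfl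
    have h1 : Fin.tail ((Fin.consEquiv fun _ => Finset K) (b, B)) = B := rfl
    simp only [rowWeight, h0, h1]
    rw [Finset.sum_mul_sum]
    refine Finset.sum_congr rfl fun s _ => Finset.sum_congr rfl fun r _ => ?_
    split_ifs <;> simp
  rw [key, sum_sum_sum_sum_comm]
  refine Finset.sum_congr rfl fun r _ => Finset.sum_congr rfl fun s _ => ?_
  -- The content of the first column between the two rows is forced by what the first row does
  -- there.
  rw [Finset.sum_eq_single (columnNext (A 0) d s)]
  · simp only [if_true]
    split_ifs
    · rw [twoRowWeight, Finset.mul_sum]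
      refine Finset.sum_congr rfl fun B _ => ?_
      rw [pairWeight]; ring
    · simp
  · intro b _ hb
    simp [hb]
  · simp

/-- Where the weight of two successive vertices does not vanish, its exit column is symmetric. -/
theorem ite_pairWeight_exchange (x y : R) {A D : Finset K} {c d : Option K}
    (hc : ∀ k, c = some k → k ∉ A) (hd : ∀ k, d = some k → k ∉ A)
    (hcd : ∀ k, c = some k → d ≠ some k) (r s : Option K) :
    (if D = columnNext (columnNext A d s) c r then pairWeight α β y x A c d r s else 0) *
          exchDiag α β x y r s +
        (if D = columnNext (columnNext A d r) c s then pairWeight α β y x A c d s r else 0) *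
          exchOff α β x y s r =
      exchDiag α β x y c d *
          (if D = columnNext (columnNext A d s) c r then pairWeight α β x y A c d r s else 0) +
        exchOff α β x y c d *
          (if D = columnNext (columnNext A c s) d r then pairWeight α β x y A d c r s else 0) := by
  -- Where the weight is nonzero, the final content is `A` with `c, d` added and `r, s` removed.
  -- This is symmetric in both pairs, so the four indicator conditions coincide.
  have key : ∀ (x y : R) (c d r s : Option K), (∀ k, c = some k → k ∉ A) →
      (∀ k, d = some k → k ∉ A) → (∀ k, c = some k → d ≠ some k) →
      (if D = columnNext (columnNext A d s) c r then pairWeight α β x y A c d r s else 0) =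
      if (∀ k, k ∈ D ↔ (k ∈ A ∨ c = some k ∨ d = some k) ∧ r ≠ some k ∧ s ≠ some k) then
        pairWeight α β x y A c d r s else 0 := by
    intro x y c d r s hc hd hcd
    by_cases h : pairWeight α β x y A c d r s = 0
    · simp [h]
    · simp only [Finset.ext_iff, columnNext_columnNext α β hc hd hcd h]
  rw [key y x c d r s hc hd hcd, key y x c d s r hc hd hcd, key x y c d r s hc hd hcd,
    key x y d c r s hd hc fun k hk hk' => hcd k hk' hk]
  simp only [or_comm (a := d = some _), and_comm (a := s ≠ some _)]
  split_ifs
  · exact pairWeight_exchange α β x y hc hd hcd r s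
  · simp

/-- Train argument: the crossing passes through the columns one by one. At the far end both rows are
empty, so it acts there by the scalar on the left. -/
theorem twoRowWeight_exchange (x y : R) (N : ℕ) (c d : Option K) (A D : Fin N → Finset K)
    (hA : ∀ i j, i ≠ j → Disjoint (A i) (A j))
    (hc : ∀ k, c = some k → ∀ i, k ∉ A i) (hd : ∀ k, d = some k → ∀ i, k ∉ A i)
    (hcd : ∀ k, c = some k → d ≠ some k) :
    (1 + (α + β) * y + α * β * x * y) * twoRowWeight α β y x N c d A D =
      exchDiag α β x y c d * twoRowWeight α β x y N c d A D +
        exchOff α β x y c d * twoRowWeight α β x y N d c A D := by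
  induction N generalizing c d with
  | zero =>
    rcases c with _ | c <;> rcases d with _ | d <;>
      simp [twoRowWeight, rowWeight, exchDiag, exchOff]
  | succ N ih =>
    -- The crossing is first resolved beyond column `0` by induction; a nonzero pair weight
    -- guarantees that `r` and `s` satisfy the induction hypotheses.
    have step : ∀ r s : Option K,
        (1 + (α + β) * y + α * β * x * y) *
          ((if D 0 = columnNext (columnNext (A 0) d s) c r then
            pairWeight α β y x (A 0) c d r s else 0) *
            twoRowWeight α β y x N r s (Fin.tail A) (Fin.tail D)) =
        (if D 0 = columnNext (columnNext (A 0) d s) c r then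
            pairWeight α β y x (A 0) c d r s else 0) *
          (exchDiag α β x y r s * twoRowWeight α β x y N r s (Fin.tail A) (Fin.tail D)) +
        (if D 0 = columnNext (columnNext (A 0) d s) c r then
            pairWeight α β y x (A 0) c d r s else 0) *
          (exchOff α β x y r s * twoRowWeight α β x y N s r (Fin.tail A) (Fin.tail D)) := by
      intro r s
      by_cases h : pairWeight α β y x (A 0) c d r s = 0
      · simp [h]
      obtain ⟨hr, hs, hrs⟩ := available_of_pairWeight_ne_zero α β (fun k hk => hc k hk 0)
        (fun k hk => hd k hk 0) hcd h
      have fresh : ∀ k, k ∈ A 0 ∨ c = some k ∨ d = some k → ∀ i, k ∉ Fin.tail A i := by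
        rintro k (hk | hk | hk) i
        · exact Finset.disjoint_left.1 (hA 0 i.succ (Fin.succ_ne_zero i).symm) hk
        · exact hc k hk i.succ
        · exact hd k hk i.succ
      rw [mul_left_comm, ih r s (Fin.tail A) (Fin.tail D)
        (fun i j hij => hA _ _ fun h => hij (Fin.succ_injective _ h))
        (fun k hk => fresh k (hr k hk)) (fun k hk => fresh k (hs k hk)) hrs, mul_add]
    simp only [twoRowWeight_succ, Finset.mul_sum]
    simp only [step, Finset.sum_add_distrib]
    -- Renaming `r ↔ s` in the off-diagonal part collects the coefficient of one and the same
    -- `twoRowWeight`.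
    rw [Finset.sum_comm (f := fun r s : Option K =>
      (if D 0 = columnNext (columnNext (A 0) d s) c r then
            pairWeight α β y x (A 0) c d r s else 0) *
          (exchOff α β x y r s * twoRowWeight α β x y N s r (Fin.tail A) (Fin.tail D)))]
    simp only [← Finset.sum_add_distrib]
    refine Finset.sum_congr rfl fun r _ => Finset.sum_congr rfl fun s _ => ?_
    linear_combination twoRowWeight α β x y N r s (Fin.tail A) (Fin.tail D) *
      ite_pairWeight_exchange α β x y (A := A 0) (D := D 0) (fun k hk => hc k hk 0)
        (fun k hk => hd k hk 0) hcd r s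

end Rows

/-! ### The partition function: exchange, frozen rows, positivity -/

section PartitionFunction

variable {R : Type*} [CommRing R] {K : Type*} [LinearOrder K] [Fintype K] (α β : R)

/-- Rows only move colours around, so a new colour keeps the columns disjoint. This supplies the
freshness hypotheses of `twoRowWeight_exchange` inside a stack of rows. -/
theorem columns_of_rowWeight_ne_zero {x : R} {N : ℕ} {h : Option K} {A B : Fin N → Finset K}
    (hA : ∀ i j, i ≠ j → Disjoint (A i) (A j)) (hh : ∀ k, h = some k → ∀ i, k ∉ A i)
    (hw : rowWeight α β x N h A B ≠ 0) :
    (∀ i j, i ≠ j → Disjoint (B i) (B j)) ∧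
      ∀ i, ∀ k ∈ B i, h = some k ∨ ∃ j, k ∈ A j := by
  induction N generalizing h with
  | zero => exact ⟨fun i => i.elim0, fun i => i.elim0⟩
  | succ N ih =>
    obtain ⟨r, -, hr⟩ := Finset.exists_ne_zero_of_sum_ne_zero hw
    obtain ⟨hB, hr⟩ := ite_ne_right_iff.1 hr
    have hA' : ∀ i j, i ≠ j → Disjoint (Fin.tail A i) (Fin.tail A j) :=
      fun i j hij => hA _ _ fun e => hij (Fin.succ_injective _ e)
    have hv := left_ne_zero_of_mul hr
    have avail : ∀ k, r = some k → h = some k ∨ k ∈ A 0 := by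
      rintro k rfl
      rcases h with _ | h <;> simp [vertexWeight] at hv ⊢ <;> grind
    have memB : ∀ k ∈ B 0, (h = some k ∨ k ∈ A 0) ∧ r ≠ some k := by
      intro k hk
      rw [hB] at hk
      rcases h with _ | h <;> rcases r with _ | r <;> simp [columnNext] at hk ⊢ <;> grind
    have notMem : ∀ k, h = some k ∨ k ∈ A 0 → ∀ i : Fin N, k ∉ Fin.tail A i := by
      rintro k (hk | hk) i
      · exact hh k hk _
      · exact Finset.disjoint_left.1 (hA 0 _ (Fin.succ_ne_zero i).symm) hk
    obtain ⟨h1, h2⟩ := ih hA' (fun k hk => notMem k (avail k hk)) (right_ne_zero_of_mul hr)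
    have h3 : ∀ i : Fin N, Disjoint (B 0) (B i.succ) := by
      intro i
      refine Finset.disjoint_left.2 fun k hk hk' => ?_
      obtain ⟨hk1, hk2⟩ := memB k hk
      rcases h2 i k hk' with h4 | ⟨j, hj⟩
      · exact hk2 h4
      · exact notMem k hk1 j hj
    refine ⟨fun i j hij => ?_, fun i k hk => ?_⟩
    · cases i using Fin.cases <;> cases j using Fin.cases
      · exact absurd rfl hij
      · exact h3 _
      · exact (h3 _).symm
      · exact h1 _ _ fun e => hij (congrArg _ e)
    · cases i using Fin.cases with
      | zero =>
        rcases (memB k hk).1 with h4 | h4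
        · exact Or.inl h4
        · exact Or.inr ⟨0, h4⟩
      | succ i =>
        rcases h2 i k hk with h4 | ⟨j, hj⟩
        · rcases avail k h4 with h5 | h5
          · exact Or.inl h5
          · exact Or.inr ⟨0, h5⟩
        · exact Or.inr ⟨j.succ, hj⟩

/-- The partition function of a list of rows, each given by its spectral parameter and the colour
entering it, the last row of the list coming first; all columns are initially empty. -/
def rowsWeight {N : ℕ} : List (R × K) → (Fin N → Finset K) → R
  | [], D => if D = fun _ => ∅ then 1 else 0
  | p :: l, D => ∑ B : Fin N → Finset K,
      rowsWeight l B * rowWeight α β p.1 N (some p.2) B D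

theorem columns_of_rowsWeight_ne_zero {N : ℕ} {l : List (R × K)} {D : Fin N → Finset K}
    (hl : (l.map Prod.snd).Nodup) (hw : rowsWeight α β l D ≠ 0) :
    (∀ i j, i ≠ j → Disjoint (D i) (D j)) ∧ ∀ i, ∀ k ∈ D i, k ∈ l.map Prod.snd := by
  induction l generalizing D with
  | nil =>
    obtain ⟨rfl, -⟩ := ite_ne_right_iff.1 hw
    simp
  | cons p l ih =>
    obtain ⟨B, -, hB⟩ := Finset.exists_ne_zero_of_sum_ne_zero hw
    rw [List.map_cons, List.nodup_cons] at hl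
    obtain ⟨h1, h2⟩ := ih hl.2 (left_ne_zero_of_mul hB)
    obtain ⟨h3, h4⟩ := columns_of_rowWeight_ne_zero α β h1
      (by rintro k ⟨⟩ i hk; exact hl.1 (h2 i _ hk)) (right_ne_zero_of_mul hB)
    refine ⟨h3, fun i k hk => ?_⟩
    rw [List.map_cons, List.mem_cons]
    rcases h4 i k hk with h5 | ⟨j, hj⟩
    · exact Or.inl (Option.some_injective _ h5).symm
    · exact Or.inr (h2 j k hj)

theorem rowsWeight_cons_cons {N : ℕ} (x y : R) (c d : K) (l : List (R × K))
    (D : Fin N → Finset K) :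
    rowsWeight α β ((x, c) :: (y, d) :: l) D =
      ∑ A : Fin N → Finset K,
        rowsWeight α β l A * twoRowWeight α β x y N (some c) (some d) A D := by
  simp only [rowsWeight, twoRowWeight, Finset.sum_mul, Finset.mul_sum]
  rw [Finset.sum_comm]
  simp only [mul_assoc]

/-- The rows of `l` act first and bring in only their own colours, so `c` and `d` are still fresh.
The rows of `l'` act afterwards and linearly, so they preserve the relation. -/
theorem rowsWeight_exchange {N : ℕ} (x y : R) {c d : K} (hcd : c < d) (l l' : List (R × K))
    (hl : (c :: d :: l.map Prod.snd).Nodup) (D : Fin N → Finset K) :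
    (1 + (α + β) * y + α * β * x * y) * rowsWeight α β (l' ++ (y, c) :: (x, d) :: l) D =
      (1 + α * y) * (1 + β * x) * rowsWeight α β (l' ++ (x, c) :: (y, d) :: l) D +
        β * (y - x) * rowsWeight α β (l' ++ (x, d) :: (y, c) :: l) D := by
  induction l' generalizing D with
  | nil =>
    simp only [List.nodup_cons, List.mem_cons, not_or] at hl
    simp only [List.nil_append, rowsWeight_cons_cons, Finset.mul_sum, ← Finset.sum_add_distrib]
    refine Finset.sum_congr rfl fun A _ => ?_
    by_cases hA : rowsWeight α β l A = 0
    · simp [hA]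
    obtain ⟨h1, h2⟩ := columns_of_rowsWeight_ne_zero α β hl.2.2 hA
    have h := twoRowWeight_exchange α β x y N (some c) (some d) A D h1
      (by rintro k ⟨⟩ i hk; exact hl.1.2 (h2 i _ hk))
      (by rintro k ⟨⟩ i hk; exact hl.2.1 (h2 i _ hk))
      (by rintro k ⟨⟩ h; exact hl.1.1 (Option.some_injective _ h).symm)
    simp only [exchDiag, exchOff, if_pos hcd] at h
    linear_combination rowsWeight α β l A * h
  | cons p l' ih =>
    simp only [List.cons_append, rowsWeight, Finset.mul_sum, ← Finset.sum_add_distrib]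
    refine Finset.sum_congr rfl fun B _ => ?_
    linear_combination rowWeight α β p.1 N (some p.2) B D * ih B

/-- A row leaves empty, so whatever colour it carries must be dropped in some column. -/
theorem rowWeight_some_empty (x : R) {N : ℕ} (k : K) (B : Fin N → Finset K) :
    rowWeight α β x N (some k) B (fun _ => ∅) = 0 := by
  induction N generalizing k with
  | zero => rfl
  | succ N ih =>
    refine Finset.sum_eq_zero fun r _ => ?_
    rcases r with _ | r
    · rw [if_neg]
      exact (Finset.insert_ne_empty k _).symm
    · have h := ih r (Fin.tail B)
      rw [show (Fin.tail fun _ : Fin (N + 1) => (∅ : Finset K)) = fun _ => ∅ from rfl, h]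
      simp

theorem rowWeight_none_empty (x : R) {N : ℕ} (B : Fin N → Finset K) :
    rowWeight α β x N none B (fun _ => ∅) = if B = fun _ => ∅ then 1 else 0 := by
  induction N with
  | zero => simp [rowWeight, Subsingleton.elim B fun _ => ∅]
  | succ N ih =>
    have hB : (B = fun _ => ∅) ↔ B 0 = ∅ ∧ Fin.tail B = fun _ => ∅ := by
      refine ⟨by rintro rfl; exact ⟨rfl, rfl⟩, fun h => funext fun i => ?_⟩
      cases i using Fin.cases with
      | zero => exact h.1
      | succ i => exact congrFun h.2 i
    have ht : (Fin.tail fun _ : Fin (N + 1) => (∅ : Finset K)) = fun _ => ∅ := rfl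
    rw [rowWeight, Fintype.sum_option]
    simp only [ht, rowWeight_some_empty, ih, mul_zero, ite_self, Finset.sum_const_zero, add_zero,
      columnNext, hB, eq_comm (a := (∅ : Finset K))]
    by_cases h : B 0 = ∅ <;> simp [h, vertexWeight, homInt]

/-- A row whose colour is smaller than all the others and leaves last is frozen. -/
theorem rowWeight_frozen (x : R) {N : ℕ} {k : K} {p : Fin N} {B D : Fin N → Finset K}
    (hB : ∀ j, k ∉ B j) (hp : D p = {k}) (hlt : ∀ j < p, ∃ a, k < a ∧ D j = {a})
    (hgt : ∀ j, p < j → D j = ∅) :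
    rowWeight α β x N (some k) B D =
      if B = Function.update D p ∅ then (β * x) ^ (p : ℕ) else 0 := by
  induction N with
  | zero => exact p.elim0
  | succ N ih =>
    rw [rowWeight]
    cases p using Fin.cases with
    | zero =>
      have ht : Fin.tail D = fun _ => ∅ := funext fun i => hgt _ (Fin.succ_pos i)
      have hu : Function.update D 0 ∅ = fun _ => ∅ := by
        funext j
        cases j using Fin.cases with
        | zero => simp
        | succ j => simp [hgt _ (Fin.succ_pos j)]
      have hBe : (B = fun _ => ∅) ↔ B 0 = ∅ ∧ Fin.tail B = fun _ => ∅ := by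
        refine ⟨by rintro rfl; exact ⟨rfl, rfl⟩, fun h => funext fun i => ?_⟩
        cases i using Fin.cases with
        | zero => exact h.1
        | succ i => exact congrFun h.2 i
      have h0 : ({k} = insert k (B 0)) ↔ B 0 = ∅ := by
        have := hB 0
        constructor
        · intro h
          refine Finset.eq_empty_of_forall_notMem fun a ha => this ?_
          have : a ∈ ({k} : Finset K) := h ▸ Finset.mem_insert_of_mem ha
          rwa [Finset.mem_singleton.1 this] at ha
        · intro h; simp [h]
      rw [Fintype.sum_option]
      simp only [ht, hu, hp, rowWeight_some_empty, rowWeight_none_empty, mul_zero, ite_self,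
        Finset.sum_const_zero, add_zero, columnNext, hBe, h0]
      by_cases h : B 0 = ∅ <;> simp [h, vertexWeight, homInt]
    | succ p =>
      obtain ⟨a, hka, ha⟩ := hlt 0 (Fin.succ_pos p)
      -- Column `0` ends as `{a}` with `a ≠ k`, so the row cannot drop `k` there; passing the larger
      -- colour `a` costs `β * x`.
      rw [Finset.sum_eq_single (some k)]
      · rw [ih (p := p) (B := Fin.tail B) (D := Fin.tail D) (fun j => hB _) hp (fun j hj => hlt _ (Fin.succ_lt_succ_iff.2 hj))
          (fun j hj => hgt _ (Fin.succ_lt_succ_iff.2 hj))]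
        have hn : columnNext (B 0) (some k) (some k) = B 0 := Finset.erase_insert (hB 0)
        have hBe : (B = Function.update D p.succ ∅) ↔
            B 0 = {a} ∧ Fin.tail B = Function.update (Fin.tail D) p ∅ := by
          rw [← Fin.tail_update_succ, ← ha]
          refine ⟨by rintro rfl; exact ⟨by simp [Function.update, (Fin.succ_ne_zero p).symm], rfl⟩,
            fun h => funext fun i => ?_⟩
          cases i using Fin.cases with
          | zero => rw [h.1]; simp [Function.update, (Fin.succ_ne_zero p).symm]
          | succ i => exact congrFun h.2 i
        rw [hn, ha]
        by_cases h : B 0 = {a}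
        · simp only [h, if_true, hBe, true_and, vertexWeight, overFactor,
            Finset.prod_singleton, if_neg hka.not_gt, if_pos hka]
          split_ifs
          · rw [Fin.val_succ]; ring
          · simp
        · simp [hBe, h, Ne.symm h]
      · intro r _ hr
        refine if_neg fun h => hka.ne' ?_
        rw [ha] at h
        have hk : k ∈ columnNext (B 0) (some k) r := by
          rcases r with _ | r
          · simp [columnNext]
          · have : k ≠ r := fun h => hr (by rw [h])
            simp [columnNext, this]
        rw [← h, Finset.mem_singleton] at hk
        exact hk.symm
      · simp

/-- Positivity: the weights are built from `α`, `β`, `x` by sums and products only. Signs occur only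
in the exchange coefficients, which do not enter the partition function. -/
theorem rowWeight_mem {S : Subsemiring R} (hα : α ∈ S) (hβ : β ∈ S) {x : R} (hx : x ∈ S) {N : ℕ}
    (h : Option K) (A B : Fin N → Finset K) : rowWeight α β x N h A B ∈ S := by
  have hI : ∀ m, homInt α β m ∈ S := by
    intro m
    induction m with
    | zero => exact S.zero_mem
    | succ m ih => exact S.add_mem (S.pow_mem hα m) (S.mul_mem hβ ih)
  have hO : ∀ (A : Finset K) (j : K), overFactor α β A j ∈ S := fun A j =>
    S.prod_mem fun a _ => by split_ifs <;> first | assumption | exact S.one_mem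
  have hv : ∀ (A : Finset K) (h r : Option K), vertexWeight α β x A h r ∈ S := by
    have h1 : 1 + α * x ∈ S := S.add_mem S.one_mem (S.mul_mem hα hx)
    have h2 : 1 + β * x ∈ S := S.add_mem S.one_mem (S.mul_mem hβ hx)
    rintro A (_ | i) (_ | j) <;> simp only [vertexWeight]
    · exact S.add_mem (hI _) (S.mul_mem (S.mul_mem (S.mul_mem hα hβ) hx) (hI _))
    · split_ifs
      · exact S.mul_mem (S.mul_mem h1 h2) (hO _ _)
      · exact S.zero_mem
    · exact hI _
    · split_ifs
      · exact S.mul_mem hx (hO _ _)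
      · exact S.mul_mem h2 (hO _ _)
      · exact S.mul_mem h1 (hO _ _)
      · exact S.zero_mem
  induction N generalizing h with
  | zero => rcases h with _ | h; exacts [S.one_mem, S.zero_mem]
  | succ N ih =>
    refine S.sum_mem fun r _ => ?_
    split_ifs
    · exact S.mul_mem (hv _ _ _) (ih _ _ _)
    · exact S.zero_mem

theorem rowsWeight_mem {S : Subsemiring R} (hα : α ∈ S) (hβ : β ∈ S) {N : ℕ} {l : List (R × K)}
    (hl : ∀ p ∈ l, p.1 ∈ S) (D : Fin N → Finset K) : rowsWeight α β l D ∈ S := by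
  induction l generalizing D with
  | nil =>
    rw [rowsWeight]
    split_ifs
    exacts [S.one_mem, S.zero_mem]
  | cons p l ih =>
    exact S.sum_mem fun B _ => S.mul_mem (ih (fun q hq => hl q (List.mem_cons_of_mem _ hq)) B)
      (rowWeight_mem α β hα hβ (hl p List.mem_cons_self) _ _ _)

variable {R' : Type*} [CommRing R'] (φ : R →+* R')

theorem map_rowWeight (x : R) {N : ℕ} (h : Option K) (A B : Fin N → Finset K) :
    φ (rowWeight α β x N h A B) = rowWeight (φ α) (φ β) (φ x) N h A B := by
  have hI : ∀ m, φ (homInt α β m) = homInt (φ α) (φ β) m := by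
    intro m
    induction m with
    | zero => exact map_zero φ
    | succ m ih => simp [homInt, ih]
  have hO : ∀ (A : Finset K) (j : K), φ (overFactor α β A j) = overFactor (φ α) (φ β) A j := by
    intro A j
    simp only [overFactor, map_prod]
    exact Finset.prod_congr rfl fun a _ => by split_ifs <;> simp
  have hv : ∀ (A : Finset K) (h r : Option K),
      φ (vertexWeight α β x A h r) = vertexWeight (φ α) (φ β) (φ x) A h r := by
    rintro A (_ | i) (_ | j) <;> simp only [vertexWeight] <;>
      (try split_ifs) <;> simp [hI, hO]
  induction N generalizing h with
  | zero => rcases h with _ | h <;> simp [rowWeight]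
  | succ N ih =>
    simp only [rowWeight, map_sum]
    exact Finset.sum_congr rfl fun r _ => by split_ifs <;> simp [hv, ih]

/-- For `φ` a renaming of variables, this permutes the spectral parameters and leaves the colours in
place. -/
theorem map_rowsWeight {N : ℕ} (l : List (R × K)) (D : Fin N → Finset K) :
    φ (rowsWeight α β l D) = rowsWeight (φ α) (φ β) (l.map fun p => (φ p.1, p.2)) D := by
  induction l generalizing D with
  | nil => simp only [rowsWeight, List.map_nil]; split_ifs <;> simp
  | cons p l ih => simp [rowsWeight, ih, map_rowWeight]

end PartitionFunction

/-! ### The unique configuration for the identity permutation -/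

section Frozen

variable {R : Type*} [CommRing R] (α β : R)

/-- The colours enter in decreasing order. Each new colour `k` is smaller than those already placed,
passes the `k.rev` occupied columns with weight `β * X k` each, and stops in the next one. -/
theorem rowsWeight_frozen {n : ℕ} (X : Fin n → R) (m : ℕ) (hm : m ≤ n) :
    rowsWeight α β (((List.finRange n).drop (n - m)).map fun i => (X i, i))
        (fun j : Fin n => if n - m ≤ (j.rev : ℕ) then {j.rev} else ∅) =
      (((List.finRange n).drop (n - m)).map fun i => (β * X i) ^ (i.rev : ℕ)).prod := by
  induction m with
  | zero =>
    have h : (fun j : Fin n => if n ≤ (j.rev : ℕ) then ({j.rev} : Finset (Fin n)) else ∅) =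
        fun _ => ∅ := funext fun j => if_neg (by omega)
    rw [Nat.sub_zero, List.drop_eq_nil_of_le (by simp), h]
    simp [rowsWeight]
  | succ m ih =>
    have hlt : n - (m + 1) < (List.finRange n).length := by rw [List.length_finRange]; omega
    have hs : n - (m + 1) + 1 = n - m := by omega
    obtain ⟨k, hk⟩ : ∃ k : Fin n, (k : ℕ) = n - (m + 1) := ⟨⟨n - (m + 1), by omega⟩, rfl⟩
    have hdrop : (List.finRange n).drop (n - (m + 1)) = k :: (List.finRange n).drop (n - m) := by
      rw [List.drop_eq_getElem_cons hlt, hs]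
      congr 1
      rw [List.getElem_finRange]
      exact Fin.ext hk.symm
    have hnodup : (((List.finRange n).drop (n - m)).map fun i => (X i, i)).map Prod.snd =
        (List.finRange n).drop (n - m) := by
      rw [List.map_map]; exact List.map_id _
    have hnd := (List.nodup_finRange n).sublist (List.drop_sublist (n - (m + 1)) _)
    rw [hdrop, List.nodup_cons] at hnd
    rw [hdrop, List.map_cons, List.map_cons, List.prod_cons, ← ih (by omega), rowsWeight]
    rw [Finset.sum_eq_single (fun j : Fin n => if n - m ≤ (j.rev : ℕ) then {j.rev} else ∅)]
    · by_cases h0 : rowsWeight α β (((List.finRange n).drop (n - m)).map fun i => (X i, i))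
        (fun j : Fin n => if n - m ≤ (j.rev : ℕ) then {j.rev} else ∅) = 0
      · rw [h0]; simp only [zero_mul, mul_zero]
      · rw [rowWeight_frozen α β (p := k.rev), if_pos, mul_comm]
        · funext j
          by_cases hj : j = k.rev
          · subst hj
            simp only [Fin.rev_rev, Function.update_self]
            exact if_neg (by omega)
          · rw [Function.update_of_ne hj]
            have : (j.rev : ℕ) ≠ k := fun h => hj (by rw [← Fin.ext h, Fin.rev_rev])
            congr 1
            simp only [eq_iff_iff]
            omega
        · intro j hj
          split_ifs at hj with h
          · rw [Finset.mem_singleton] at hj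
            subst hj
            omega
          · simp at hj
        · simp [hk]
        · intro j hj
          have h1 : k < j.rev := by rwa [Fin.lt_rev_iff]
          exact ⟨j.rev, h1, if_pos (by have := Fin.lt_def.1 h1; omega)⟩
        · intro j hj
          have h1 : j.rev < k := by rwa [Fin.rev_lt_iff]
          exact if_neg (by have := Fin.lt_def.1 h1; omega)
    · intro B _ hB
      by_cases h0 : rowsWeight α β (((List.finRange n).drop (n - m)).map fun i => (X i, i)) B = 0
      · rw [h0]; simp only [zero_mul]
      -- A contributing state contains only colours of earlier rows, hence not `k`, so
      -- `rowWeight_frozen` applies.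
      · obtain ⟨-, h2⟩ := columns_of_rowsWeight_ne_zero α β (by rw [hnodup]; exact hnd.2) h0
        rw [hnodup] at h2
        rw [rowWeight_frozen α β (p := k.rev), if_neg, mul_zero]
        · intro h
          refine hB (h.trans ?_)
          funext j
          by_cases hj : j = k.rev
          · subst hj
            simp only [Fin.rev_rev, Function.update_self]
            exact (if_neg (by omega)).symm
          · rw [Function.update_of_ne hj]
            have : (j.rev : ℕ) ≠ k := fun h => hj (by rw [← Fin.ext h, Fin.rev_rev])
            congr 1
            simp only [eq_iff_iff]
            omega
        · exact fun j hj => hnd.1 (h2 j k hj)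
        · simp [hk]
        · intro j hj
          have h1 : k < j.rev := by rwa [Fin.lt_rev_iff]
          exact ⟨j.rev, h1, if_pos (by have := Fin.lt_def.1 h1; omega)⟩
        · intro j hj
          have h1 : j.rev < k := by rwa [Fin.rev_lt_iff]
          exact if_neg (by have := Fin.lt_def.1 h1; omega)
    · simp

end Frozen

/-! ### Reduced words and inversions -/

section Words

variable {n : ℕ}

/-- The number of inversions of a permutation. -/
def inversions (w : Equiv.Perm (Fin n)) : Finset (Fin n × Fin n) :=
  Finset.univ.filter fun p => p.1 < p.2 ∧ w p.2 < w p.1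

theorem lo_lt_hi (i : Fin (n - 1)) : lo i < hi i := Fin.lt_def.2 (Nat.lt_succ_self _)

theorem mem_inversions {w : Equiv.Perm (Fin n)} {p : Fin n × Fin n} :
    p ∈ inversions w ↔ p.1 < p.2 ∧ w p.2 < w p.1 := by simp [inversions]

/-- `s_i` preserves the order of every pair of positions except `(lo i, hi i)`, so the inversions of
`w s_i` are the images of those of `w` together with that one pair. -/
theorem card_inversions_mul_simpleRefl (w : Equiv.Perm (Fin n)) (i : Fin (n - 1))
    (h : w (lo i) < w (hi i)) :
    (inversions (w * simpleRefl i)).card = (inversions w).card + 1 := by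
  have hs : ∀ a b : Fin n, a < b → simpleRefl i a < simpleRefl i b ∨ (a = lo i ∧ b = hi i) := by
    intro a b hab
    simp only [simpleRefl, Equiv.swap_apply_def, lo, hi, Fin.ext_iff, Fin.lt_def] at *
    split_ifs <;> simp <;> omega
  have hss : ∀ a, simpleRefl i (simpleRefl i a) = a := fun a => by simp [simpleRefl]
  have hlo : simpleRefl i (lo i) = hi i := Equiv.swap_apply_left _ _
  have hhi : simpleRefl i (hi i) = lo i := Equiv.swap_apply_right _ _
  have h1 : inversions (w * simpleRefl i) = insert (lo i, hi i)
      ((inversions w).map (Equiv.prodCongr (simpleRefl i) (simpleRefl i)).toEmbedding) := by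
    ext ⟨a, b⟩
    rw [Finset.mem_insert, Finset.mem_map_equiv]
    have hsymm : (Equiv.prodCongr (simpleRefl i) (simpleRefl i)).symm (a, b) =
        (simpleRefl i a, simpleRefl i b) := by
      rw [Equiv.symm_apply_eq]; simp [hss]
    rw [hsymm]
    rw [mem_inversions, mem_inversions, Prod.mk.injEq]
    simp only [Equiv.Perm.mul_apply]
    constructor
    · rintro ⟨hab, hw⟩
      rcases hs a b hab with h2 | h2
      · exact Or.inr ⟨h2, hw⟩
      · exact Or.inl h2
    · rintro (⟨rfl, rfl⟩ | ⟨hab, hw⟩)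
      · rw [hlo, hhi]; exact ⟨lo_lt_hi i, h⟩
      · refine ⟨?_, hw⟩
        rcases hs _ _ hab with h2 | ⟨h2, h3⟩
        · rwa [hss, hss] at h2
        · rw [h2, h3] at hw; exact absurd hw h.not_gt
  rw [h1, Finset.card_insert_of_notMem, Finset.card_map]
  rw [Finset.mem_map_equiv]
  have hsymm : (Equiv.prodCongr (simpleRefl i) (simpleRefl i)).symm (lo i, hi i) =
      (hi i, lo i) := by
    rw [Equiv.symm_apply_eq]; simp [hlo, hhi]
  rw [hsymm]
  simp [inversions, (lo_lt_hi i).not_gt]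

theorem simpleRefl_mul_self (i : Fin (n - 1)) : simpleRefl i * simpleRefl i = 1 :=
  Equiv.swap_mul_self _ _

/-- Inverses appear because words grow on the left: `(s_i u)⁻¹ = u⁻¹ s_i` turns this into an
exchange of adjacent positions. -/
theorem card_inversions_le (l : List (Fin (n - 1))) :
    (inversions (wordProd l)⁻¹).card ≤ l.length := by
  induction l with
  | nil =>
    have : inversions (1 : Equiv.Perm (Fin n)) = ∅ :=
      Finset.filter_eq_empty_iff.2 fun p _ h => h.1.not_gt h.2
    simp [wordProd, this]
  | cons i l ih =>
    have hw : (wordProd (i :: l))⁻¹ = (wordProd l)⁻¹ * simpleRefl i := by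
      simp [wordProd, simpleRefl]
    rw [hw, List.length_cons]
    rcases lt_or_gt_of_ne ((wordProd l)⁻¹.injective.ne (lo_lt_hi i).ne) with h | h
    · rw [card_inversions_mul_simpleRefl _ i h]; omega
    · have := card_inversions_mul_simpleRefl ((wordProd l)⁻¹ * simpleRefl i) i
        (by simpa [simpleRefl] using h)
      rw [mul_assoc, simpleRefl_mul_self, mul_one] at this
      omega

/-- Bubble sort: without adjacent descents `w⁻¹` is increasing, hence the identity; otherwise
undoing a descent removes one inversion. -/
theorem exists_word_length (w : Equiv.Perm (Fin n)) :
    ∃ l : List (Fin (n - 1)), wordProd l = w ∧ l.length = (inversions w⁻¹).card := by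
  induction hN : (inversions w⁻¹).card generalizing w with
  | zero =>
    refine ⟨[], ?_, rfl⟩
    have hmono : StrictMono (w⁻¹ : Equiv.Perm (Fin n)) := by
      intro a b hab
      refine lt_of_le_of_ne (not_lt.1 fun h => ?_) (w⁻¹.injective.ne hab.ne)
      have : (a, b) ∈ inversions w⁻¹ := mem_inversions.2 ⟨hab, h⟩
      rw [Finset.card_eq_zero.1 hN] at this
      simp at this
    have : ⇑(w⁻¹ : Equiv.Perm (Fin n)) = id := hmono.eq_id
    have h1 : w⁻¹ = 1 := Equiv.ext fun x => congrFun this x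
    rw [inv_eq_one.1 h1]
    rfl
  | succ N ih =>
    obtain ⟨i, hi⟩ : ∃ i : Fin (n - 1), w⁻¹ (hi i) < w⁻¹ (lo i) := by
      by_contra! hcon
      have hmono : StrictMono (w⁻¹ : Equiv.Perm (Fin n)) := by
        rcases n with _ | m
        · exact fun a => a.elim0
        ·
          refine Fin.strictMono_iff_lt_succ.2 fun i => ?_
          exact lt_of_le_of_ne (hcon i) (w⁻¹.injective.ne (lo_lt_hi (n := m + 1) i).ne)
      have : inversions w⁻¹ = ∅ :=
        Finset.filter_eq_empty_iff.2 fun p _ h => (hmono h.1).not_gt h.2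
      simp [this] at hN
    have h := card_inversions_mul_simpleRefl (w⁻¹ * simpleRefl i) i
      (by simpa [simpleRefl] using hi)
    rw [mul_assoc, simpleRefl_mul_self, mul_one, hN] at h
    have hinv : (simpleRefl i * w)⁻¹ = w⁻¹ * simpleRefl i := by simp [simpleRefl]
    obtain ⟨l, h1, h2⟩ := ih (simpleRefl i * w) (by rw [hinv]; omega)
    refine ⟨i :: l, ?_, by rw [List.length_cons, h2]⟩
    change simpleRefl i * wordProd l = w
    rw [h1, ← mul_assoc, simpleRefl_mul_self, one_mul]

theorem IsReducedWord.length_eq {l : List (Fin (n - 1))} {w : Equiv.Perm (Fin n)}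
    (h : IsReducedWord l w) : l.length = (inversions w⁻¹).card := by
  obtain ⟨l', h1, h2⟩ := exists_word_length w
  refine le_antisymm (h2 ▸ h.2 l' h1) ?_
  rw [← h.1]
  exact card_inversions_le l

theorem IsReducedWord.tail {i : Fin (n - 1)} {l : List (Fin (n - 1))} {w : Equiv.Perm (Fin n)}
    (h : IsReducedWord (i :: l) w) : IsReducedWord l (wordProd l) := by
  refine ⟨rfl, fun l' hl' => ?_⟩
  have := h.2 (i :: l') (by rw [← h.1]; simp only [wordProd, List.map_cons, List.prod_cons] at *;
                            rw [hl'])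
  simpa using this

/-- A descent would lower the inversion number while the length grows. This ascent is the hypothesis
of `kirillovOp_latticePoly`. -/
theorem IsReducedWord.lt {i : Fin (n - 1)} {l : List (Fin (n - 1))} {w : Equiv.Perm (Fin n)}
    (h : IsReducedWord (i :: l) w) : (wordProd l)⁻¹ (lo i) < (wordProd l)⁻¹ (hi i) := by
  have h1 := h.length_eq
  have h2 := h.tail.length_eq
  have hw : w⁻¹ = (wordProd l)⁻¹ * simpleRefl i := by
    rw [← h.1]; simp [wordProd, simpleRefl]
  by_contra hcon
  have hlt := lt_of_le_of_ne (not_lt.1 hcon) ((wordProd l)⁻¹.injective.ne (lo_lt_hi i).ne')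
  have h3 := card_inversions_mul_simpleRefl ((wordProd l)⁻¹ * simpleRefl i) i
    (by simpa [simpleRefl] using hlt)
  rw [mul_assoc, simpleRefl_mul_self, mul_one, ← hw] at h3
  rw [List.length_cons] at h1
  omega

end Words

/-! ### Kirillov's operators acting on partition functions -/

section Operators

variable {S : Type*} [CommRing S] {n : ℕ} (α β : S)

/-- The partition function of the lattice model with `n` rows and columns, in which the row with
parameter `X i` is entered in the colour `c i`. -/
noncomputable def latticePoly (c : Equiv.Perm (Fin n)) : MvPolynomial (Fin n) S :=
  rowsWeight (C α) (C β) ((List.finRange n).map fun i => (X i, c i)) fun j : Fin n => {j.rev}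

theorem finRange_eq_append (i : Fin (n - 1)) :
    ∃ l' l, List.finRange n = l' ++ lo i :: hi i :: l := by
  refine ⟨(List.finRange n).take i, (List.finRange n).drop (i + 1 + 1), ?_⟩
  have h1 : (i : ℕ) + 1 < (List.finRange n).length := by rw [List.length_finRange]; omega
  conv_lhs => rw [← List.take_append_drop i (List.finRange n),
    List.drop_eq_getElem_cons (by omega : (i : ℕ) < _), List.drop_eq_getElem_cons h1]
  simp [lo, hi]

theorem latticePoly_one : latticePoly α β (1 : Equiv.Perm (Fin n)) =
    C (β ^ ∑ i : Fin n, (i.rev : ℕ)) * seed S (0 : Fin n → ℕ) := by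
  have h := rowsWeight_frozen (C α) (C β) (fun i : Fin n => (X i : MvPolynomial (Fin n) S)) n le_rfl
  simp only [Nat.sub_self, List.drop_zero, Nat.zero_le, if_true] at h
  rw [latticePoly]
  simp only [Equiv.Perm.one_apply, h]
  rw [← List.ofFn_eq_map, List.prod_ofFn, seed]
  simp only [mul_pow, Finset.prod_mul_distrib, Finset.prod_pow_eq_pow_sum, map_pow, Pi.zero_apply,
    Nat.sub_self, zero_add, Fin.val_rev]

/-- At these parameters the coefficient of `∂_i` is `1 + (α+β)y + αβxy`, the scalar of the exchange
relation. The terms in `Z_c` cancel because `(1+αy)(1+βx) + β(y-x)` equals that scalar. -/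
theorem kirillovOp_latticePoly [IsDomain S] (c : Equiv.Perm (Fin n)) (i : Fin (n - 1))
    (hc : c (lo i) < c (hi i)) :
    kirillovOp (-β) (-α) (α + β) i (latticePoly α β c) =
      C β * latticePoly α β (c * simpleRefl i) := by
  obtain ⟨l', l, hl⟩ := finRange_eq_append i
  have hnd := List.nodup_finRange n
  rw [hl] at hnd
  have hfix : ∀ j ∈ l' ++ l, simpleRefl i j = j := by
    intro j hj
    have h : j ≠ lo i ∧ j ≠ hi i := by
      simp only [List.nodup_append, List.nodup_cons, List.mem_cons, List.mem_append] at hnd hj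
      grind
    exact Equiv.swap_apply_of_ne_of_ne h.1 h.2
  have hlo : simpleRefl i (lo i) = hi i := Equiv.swap_apply_left _ _
  have hhi : simpleRefl i (hi i) = lo i := Equiv.swap_apply_right _ _
  set p := l'.map fun i => ((X i : MvPolynomial (Fin n) S), c i) with hp
  set q := l.map fun i => ((X i : MvPolynomial (Fin n) S), c i) with hq
  have hf : latticePoly α β c = rowsWeight (C α) (C β)
      (p ++ (X (lo i), c (lo i)) :: (X (hi i), c (hi i)) :: q) fun j : Fin n => {j.rev} := by
    rw [latticePoly, hl]; simp [hp, hq]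
  have hsf : rename (simpleRefl i) (latticePoly α β c) = rowsWeight (C α) (C β)
      (p ++ (X (hi i), c (lo i)) :: (X (lo i), c (hi i)) :: q) fun j : Fin n => {j.rev} := by
    rw [latticePoly, ← AlgHom.coe_toRingHom, map_rowsWeight, hl]
    simp only [AlgHom.coe_toRingHom, rename_C, List.map_map, List.map_append, List.map_cons,
      rename_X, hlo, hhi]
    congr 2
    · exact List.map_congr_left fun j hj => by simp [hfix j (by simp [hj])]
    · congr 2
      exact List.map_congr_left fun j hj => by simp [hfix j (by simp [hj])]
  -- Here the two colours are exchanged, whereas in `hsf` the two spectral parameters are.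
  have hg : latticePoly α β (c * simpleRefl i) = rowsWeight (C α) (C β)
      (p ++ (X (lo i), c (hi i)) :: (X (hi i), c (lo i)) :: q) fun j : Fin n => {j.rev} := by
    rw [latticePoly, hl]
    simp only [List.map_append, List.map_cons, Equiv.Perm.mul_apply, hlo, hhi]
    congr 2
    · exact List.map_congr_left fun j hj => by simp [hfix j (by simp [hj])]
    · congr 2
      exact List.map_congr_left fun j hj => by simp [hfix j (by simp [hj])]
  have hex := rowsWeight_exchange (C α) (C β) (X (lo i) : MvPolynomial (Fin n) S) (X (hi i)) hc q p
    (by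
      have h1 : c (lo i) :: c (hi i) :: q.map Prod.snd = (lo i :: hi i :: l).map c := by
        simp [hq]
      rw [h1]
      exact (hnd.sublist (List.sublist_append_right _ _)).map c.injective)
    fun j : Fin n => {j.rev}
  rw [← hf, ← hsf, ← hg] at hex
  have hne : (X (hi i) - X (lo i) : MvPolynomial (Fin n) S) ≠ 0 :=
    sub_ne_zero.mpr fun h => (lo_lt_hi i).ne' (X_injective h)
  have hd := divDiff_spec i (latticePoly α β c)
  refine mul_left_cancel₀ hne ?_
  rw [kirillovOp]
  simp only [map_add, map_mul, map_neg]
  linear_combination (-(1 + (C α + C β) * X (hi i) + C α * C β * X (lo i) * X (hi i))) * hd + hex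

theorem kirillovOp_C_mul [IsDomain S] (b a g t : S) (i : Fin (n - 1)) (f : MvPolynomial (Fin n) S) :
    kirillovOp b a g i (C t * f) = C t * kirillovOp b a g i f := by
  have h : C t * divDiff i f = divDiff i (C t * f) := by
    refine divDiff_unique i _ _ ?_
    rw [map_mul, rename_C]
    linear_combination C t * divDiff_spec i f
  rw [kirillovOp, ← h, kirillovOp]; ring

/-- Each letter contributes one `β`, and the frozen configuration the power on the left; both stay
as factors because `β` need not be invertible. -/
theorem C_mul_kirillovWord [IsDomain S] (l : List (Fin (n - 1)))
    (h : IsReducedWord l (wordProd l)) :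
    C (β ^ ∑ i : Fin n, (i.rev : ℕ)) * kirillovWord (-β) (-α) (α + β) l (seed S (0 : Fin n → ℕ)) =
      C (β ^ l.length) * latticePoly α β (wordProd l)⁻¹ := by
  induction l with
  | nil => simp [kirillovWord, wordProd, latticePoly_one]
  | cons i l ih =>
    have hw : (wordProd (i :: l))⁻¹ = (wordProd l)⁻¹ * simpleRefl i := by
      simp [wordProd, simpleRefl]
    change _ * kirillovOp _ _ _ i (kirillovWord _ _ _ l _) = _
    rw [← kirillovOp_C_mul, ih h.tail, kirillovOp_C_mul, kirillovOp_latticePoly α β _ i h.lt, hw,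
      List.length_cons, pow_succ, map_mul, mul_assoc]

end Operators

/-! ### Natural coefficients and the conclusion -/

theorem mem_rangeS_map_iff {σ A B : Type*} [CommSemiring A] [CommSemiring B] (φ : A →+* B)
    {f : MvPolynomial σ B} :
    f ∈ (map φ : MvPolynomial σ A →+* MvPolynomial σ B).rangeS ↔ ∀ m, coeff m f ∈ φ.rangeS := by
  constructor
  · rintro ⟨g, rfl⟩ m
    exact ⟨coeff m g, (coeff_map φ g m).symm⟩
  · intro h
    rw [f.as_sum]
    refine Subsemiring.sum_mem _ fun m _ => ?_
    obtain ⟨a, ha⟩ := h m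
    exact ⟨monomial m a, by rw [map_monomial, ha]⟩

theorem mem_natPolynomials_iff {n : ℕ} {f : MvPolynomial (Fin n) (MvPolynomial (Fin 2) ℂ)} :
    f ∈ natPolynomials n ↔ ∀ m k, coeff k (coeff m f) ∈ (Nat.castRingHom ℂ).rangeS := by
  rw [natPolynomials, mem_rangeS_map_iff]
  exact forall_congr' fun m => mem_rangeS_map_iff _

/-- Multiplication by a monomial in `α, β` shifts exponents, so every coefficient of `f` is also one
of the product. -/
theorem mem_natPolynomials_of_monomial_mul {n : ℕ}
    {f : MvPolynomial (Fin n) (MvPolynomial (Fin 2) ℂ)} (k : Fin 2 →₀ ℕ)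
    (h : C (monomial k 1) * f ∈ natPolynomials n) : f ∈ natPolynomials n := by
  rw [mem_natPolynomials_iff] at h ⊢
  intro m j
  have h := h m (k + j)
  rwa [coeff_C_mul, coeff_monomial_mul, one_mul] at h

end TwistedKirillov

/-- The first part says that the polynomial may be computed from any reduced word. -/
theorem theorem5p7 (n : ℕ) (hn : 2 ≤ n) (w : Equiv.Perm (Fin n)) :
    (∀ l : List (Fin (n - 1)), TwistedKirillov.IsReducedWord l w →
      TwistedKirillov.kirillovWord (-TwistedKirillov.paramβ) (-TwistedKirillov.paramα)
          (TwistedKirillov.paramα + TwistedKirillov.paramβ) l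
          (TwistedKirillov.seed (MvPolynomial (Fin 2) ℂ) (0 : Fin n → ℕ)) =
        TwistedKirillov.twistedKirillov (-TwistedKirillov.paramβ) (-TwistedKirillov.paramα)
          (TwistedKirillov.paramα + TwistedKirillov.paramβ) w 0) ∧
    TwistedKirillov.twistedKirillov (-TwistedKirillov.paramβ) (-TwistedKirillov.paramα)
        (TwistedKirillov.paramα + TwistedKirillov.paramβ) w 0 ∈
      TwistedKirillov.natPolynomials n := by
  open TwistedKirillov in
  -- The right side depends on `w` alone, since the length of a reduced word is the inversion
  -- number.
  have key : ∀ l : List (Fin (n - 1)), IsReducedWord l w →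
      C (paramβ ^ ∑ i : Fin n, (i.rev : ℕ)) *
        kirillovWord (-paramβ) (-paramα) (paramα + paramβ) l (seed _ (0 : Fin n → ℕ)) =
      C (paramβ ^ (inversions w⁻¹).card) * latticePoly paramα paramβ w⁻¹ := by
    intro l hl
    have hw := hl.1
    have := C_mul_kirillovWord paramα paramβ l (hw ▸ hl)
    rwa [hw, hl.length_eq] at this
  have hred := Classical.choose_spec (TwistedKirillov.exists_reducedWord w)
  refine ⟨fun l hl => ?_, ?_⟩
  · refine mul_left_cancel₀ ?_ ((key l hl).trans (key _ hred).symm)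
    exact fun h => pow_ne_zero _ (X_ne_zero (R := ℂ) (1 : Fin 2)) (C_eq_zero.1 h)
  · have h := key _ hred
    have hX : ∀ j : Fin 2, C (X j) ∈ TwistedKirillov.natPolynomials n :=
      fun j => ⟨C (X j), by simp⟩
    have hm : C (TwistedKirillov.paramβ ^ ∑ i : Fin n, (i.rev : ℕ)) *
        TwistedKirillov.twistedKirillov (-TwistedKirillov.paramβ) (-TwistedKirillov.paramα)
          (TwistedKirillov.paramα + TwistedKirillov.paramβ) w (0 : Fin n → ℕ) ∈
        TwistedKirillov.natPolynomials n := by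
      rw [TwistedKirillov.twistedKirillov, h, map_pow]
      refine Subsemiring.mul_mem _ (Subsemiring.pow_mem _ (hX 1) _)
        (TwistedKirillov.rowsWeight_mem _ _ (hX 0) (hX 1) ?_ _)
      intro p hp
      obtain ⟨i, -, rfl⟩ := List.mem_map.1 hp
      exact ⟨X i, by simp⟩
    rw [TwistedKirillov.paramβ, X_pow_eq_monomial] at hm
    exact TwistedKirillov.mem_natPolynomials_of_monomial_mul _ hm
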